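/- Let $n,k,d,r$ be integers with $d\ge 1$, $r\ge 0$, $1\le k\le n$, $n-d-r=2$ and $n$ even. Split the $n$ storage nodes into the $n/2$ families $\{1,2\},\{3,4\},\dots,\{n-1,n\}$; the candidate helper set $\overline D(x)$ of a node $x$ is the set of the $n-2=d+r$ nodes outside its family (the modified family helper selection scheme for these parameters). Let $\pi_f^*=(1,\dots,\tfrac n2,1,\dots,\tfrac n2)$, let $y_i(\pi_f^*)$ be the number of $j<i$ with $\pi_f^*(j)\ne\pi_f^*(i)$, and put $$\mathcal M=\sum_{i=1}^k\bigl(d-y_i(\pi_f^*)\bigr)^+ ,$$ which is $\sum_{i=1}^k(d-y_i(\pi_f^*))$ whenever $k\le d+1$. For a permutation $\pi$ of the nodes let $z_i(\pi)$ be the number of $j<i$ with $\pi(j)\in\overline D(\pi(i))$, let $b_i(\pi)=(d-z_i(\pi))^+$, and let $c(\pi)$ be the truncation of $b(\pi)$ at total $\mathcal M$, i.e. $c_i(\pi)=\min\{b_i(\pi),(\mathcal M-\sum_{j<i}b_j(\pi))^+\}$. Let $\mathcal H$ be the set of $h\in\{0,\dots,d\}^n$ with $\sum_i h_i=\mathcal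 M$ for which there is a permutation $\pi$ with $h_{\pi(1)}\ge\dots\ge h_{\pi(n)}$ such that $c(\pi)$ majorizes $h$ (for each $m\le n$, the sum of the $m$ largest coordinates of $c(\pi)$ is at least that of $h$). Let $\mathbb F$ be a finite field with $q>nd\,\mathcal M\,|\mathcal H|$ elements. A file is a matrix $X\in\mathbb F^{\mathcal M\times W}$ ($\mathcal M$ packets of length $W$). A code state is a tuple $Q=(Q_1,\dots,Q_n)$ of $\mathcal M\times d$ matrices over $\mathbb F$; node $i$ stores the $\alpha=d$ packets $X^TQ_i$. When a node $x$ fails, it is repaired from $d$ distinct helpers $x_1,\dots,x_d\in\overline D(x)$, which may be any $d$ elements of $\overline D(x)$ (the other $r$ being possibly unavailable); each sends $\beta=1$ packet, and $Q_x$ is replaced by $$Q_x'=[Q_{x_1}b_1,\dots,Q_{x_d}b_d]\,Z,\qquad b_1,\dots,b_d\in\mathbb F^{d},\ Z\in\mathbb F^{d\times d}.$$ Say that $Q$ satisfies the invariant if $$\prod_{h\in\mathcal H}\det\bigl([Q_1E_{h_1},\dots,Q_nE_{h_n}]\bigr)\ne 0,$$ where $Q_iE_{h_i}$ consists of the first $h_i$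 columns of $Q_i$. Then: 1. There exist an initial code state and a rule that chooses the repair coefficients $(b_1,\dots,b_d,Z)$ from the failures and helper sets that have occurred up to and including the current one, such that after every finite sequence of failures and repairs (with arbitrary failed nodes and arbitrary helper choices) the code state satisfies the invariant and every $k$ nodes determine the file; i.e. the file survives any $n-k$ failures. 2. In every code state that satisfies the invariant, every $k$ nodes determine the file. 3. If the entries of $Q_1,\dots,Q_n$ are chosen independently and uniformly from $\mathbb F$, then $Q$ satisfies the invariant with probability at least $1-nd\mathcal M|\mathcal H|/q>0$. 4. If $Q$ satisfies the invariant, then for every failed node and every choice of helpers, when the entries of $b_1,\dots,b_d,Z$ are chosen independently and uniformly from $\mathbb F$, the repaired code state satisfies the invariant with probability at least $1-2d^2|\mathcal H|/q>0$. -/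

import Mathlib

namespace MFHS

/-! ### The modified family helper selection scheme (complete families only)

Nodes are `0, …, n - 1`, families and coordinates are also counted from `0`. -/

/-- The family index of a node: consecutive blocks of `n - d - r` nodes form a family. -/
def family (n d r : ℕ) (x : Fin n) : ℕ := (x : ℕ) / (n - d - r)

/-- The candidate helper set of a node: all nodes outside its own family.  Of these, `r` may be
temporarily unavailable when the node is repaired. -/
def candidateHelpers (n d r : ℕ) (x : Fin n) : Finset (Fin n) :=
  Finset.univ.filter fun y => family n d r y ≠ family n d r x

/-- The rotating family index permutation `(1, 2, …, c, 1, 2, …, c, …)`, where `c = n / (n - d - r)`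
is the number of families. -/
def rotatingFamilyIndex (n d r : ℕ) (i : ℕ) : ℕ := i % (n / (n - d - r))

/-- `y_i` of the rotating family index permutation: the number of earlier coordinates with a
family index different from the `i`-th one. -/
def yRotating (n d r : ℕ) (i : ℕ) : ℕ :=
  ((Finset.range i).filter fun j => rotatingFamilyIndex n d r j ≠ rotatingFamilyIndex n d r i).card

/-- The file size `∑_{i=1}^k (d - y_i)^+` in packets; subtraction on `ℕ` is the positive part.
As `y_i ≤ i - 1`, no term is truncated when `k ≤ d + 1`. -/
def fileSize (n k d r : ℕ) : ℕ := ∑ i ∈ Finset.range k, (d - yRotating n d r i)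

/-! ### The set of column-count vectors -/

/-- `z_i(π)`: how many of the nodes `π(1), …, π(i-1)` are candidate helpers of `π(i)`. -/
def zCount (n d r : ℕ) (π : Equiv.Perm (Fin n)) (i : Fin n) : ℕ :=
  (Finset.univ.filter fun j => j < i ∧ π j ∈ candidateHelpers n d r (π i)).card

/-- `b_i(π) = (d - z_i(π))^+`. -/
def bVec (n d r : ℕ) (π : Equiv.Perm (Fin n)) (i : Fin n) : ℕ := d - zCount n d r π i

/-- `c(π)`: the vector `b(π)` truncated so that the running total stops at `M`. -/
def cVec (n d r M : ℕ) (π : Equiv.Perm (Fin n)) (i : Fin n) : ℕ :=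
  min (bVec n d r π i) (M - ∑ j ∈ Finset.univ.filter (fun j => j < i), bVec n d r π j)

/-- The sum of the `m` largest coordinates of `v`. -/
def largestSum {n : ℕ} (v : Fin n → ℕ) (m : ℕ) : ℕ :=
  (Finset.univ.powersetCard m).sup fun s => ∑ i ∈ s, v i

/-- `a` majorizes `b`: for every `m`, the `m` largest coordinates of `a` sum to at least as much
as the `m` largest coordinates of `b`. -/
def Majorizes {n : ℕ} (a b : Fin n → ℕ) : Prop :=
  ∀ m ∈ Finset.Icc 1 n, largestSum b m ≤ largestSum a m

/-- The set `𝓗` of vectors `h ∈ {0, …, d}^n` with total `M` such that, for some ordering `π` of the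
nodes along which `h` is non-increasing, `c(π)` majorizes `h`. -/
noncomputable def setH (n d r M : ℕ) : Finset (Fin n → Fin (d + 1)) :=
  open Classical in
  Finset.univ.filter fun h =>
    ∑ i, (h i : ℕ) = M ∧
    ∃ π : Equiv.Perm (Fin n), (∀ i j, i ≤ j → h (π j) ≤ h (π i)) ∧
      Majorizes (cVec n d r M π) fun i => (h i : ℕ)

lemma sum_of_mem_setH {n d r M : ℕ} {h : Fin n → Fin (d + 1)} (hh : h ∈ setH n d r M) :
    ∑ i, (h i : ℕ) = M := by
  classical
  unfold setH at hh
  exact (Finset.mem_filter.1 hh).2.1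

/-! ### Linear codes and their evolution under failures and repairs -/

/-- Coding matrices of all nodes at one time.  For a file `X` (an `M × W` matrix), node `i` stores
the `d` packets that are the columns of `Xᵀ * Q i`. -/
abbrev CodeState (F : Type*) (n d M : ℕ) := Fin n → Matrix (Fin M) (Fin d) F

/-- The nodes in `S` determine the file, whatever the packet length `W`. -/
def Recovers {F : Type*} [Field F] {n d M : ℕ} (Q : CodeState F n d M) (S : Finset (Fin n)) :
    Prop :=
  ∀ W : ℕ, Function.Injective
    fun (X : Matrix (Fin M) (Fin W) F) (i : S) => X.transpose * Q i

/-- The matrix `[Q_1 E_{h_1}, …, Q_n E_{h_n}]` made of the first `h_i` columns of each `Q_i`. -/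
def selectedColumns {F : Type*} {n d M : ℕ} (Q : CodeState F n d M) (h : Fin n → Fin (d + 1)) :
    Matrix (Fin M) (Σ i : Fin n, Fin (h i)) F :=
  Matrix.of fun a p => Q p.1 a (Fin.castLE (Nat.le_of_lt_succ (h p.1).isLt) p.2)

/-- The determinant of `[Q_1 E_{h_1}, …, Q_n E_{h_n}]`, whose columns are listed in this order. -/
noncomputable def selectedDet {F : Type*} [Field F] {n d M : ℕ} (Q : CodeState F n d M)
    (h : Fin n → Fin (d + 1)) (hsum : ∑ i, (h i : ℕ) = M) : F :=
  ((selectedColumns Q h).submatrix id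
    (fun j : Fin M => finSigmaFinEquiv.symm (finCongr hsum.symm j))).det

/-- The product over `𝓗` of the determinants of the selected columns is nonzero. -/
def Invariant {F : Type*} [Field F] {n d M : ℕ} (r : ℕ) (Q : CodeState F n d M) : Prop :=
  ∏ h : setH n d r M, selectedDet Q h.1 (sum_of_mem_setH h.2) ≠ 0

/-- One failure followed by a repair: the failed node and the `d` distinct helpers, which may be
any `d` nodes of its candidate helper set. -/
structure RepairEvent (n d r : ℕ) where
  failed : Fin n
  helper : Fin d ↪ Fin n
  helper_mem : ∀ i, helper i ∈ candidateHelpers n d r failed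

/-- The coefficients of one repair: the vectors `b_1, …, b_d` by which the helpers form the single
packet that each of them sends, and the matrix `Z` which the newcomer applies to the `d` received
packets. -/
abbrev RepairCoeffs (F : Type*) (d : ℕ) := (Fin d → Fin d → F) × Matrix (Fin d) (Fin d) F

/-- The newcomer's coding matrix `[Q_{x_1} b_1, …, Q_{x_d} b_d] Z`. -/
def newcomer {F : Type*} [Field F] {n d r M : ℕ} (Q : CodeState F n d M)
    (e : RepairEvent n d r) (c : RepairCoeffs F d) : Matrix (Fin M) (Fin d) F :=
  (Matrix.of fun a j => (Q (e.helper j)).mulVec (c.1 j) a) * c.2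

/-- The coding matrices after a repair. -/
def repair {F : Type*} [Field F] {n d r M : ℕ} (Q : CodeState F n d M)
    (e : RepairEvent n d r) (c : RepairCoeffs F d) : CodeState F n d M :=
  Function.update Q e.failed (newcomer Q e c)

/-- A linear locally repairable regenerating code with `d` packets stored per node and one packet
sent per helper: the initial coding matrices, and a rule choosing the repair coefficients
from the events so far (latest first) and the current event, without knowledge of future events. -/
structure LinearLRRC (F : Type*) (n d r M : ℕ) where
  init : CodeState F n d M
  rule : List (RepairEvent n d r) → RepairEvent n d r → RepairCoeffs F d

/-- The coding matrices after a finite sequence of failures and repairs (latest first). -/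
def LinearLRRC.state {F : Type*} [Field F] {n d r M : ℕ} (C : LinearLRRC F n d r M) :
    List (RepairEvent n d r) → CodeState F n d M
  | [] => C.init
  | e :: es => repair (C.state es) e (C.rule es e)

/-- The probability of `P` under the uniform distribution on a finite type. -/
noncomputable def uniformProb {α : Type*} (P : α → Prop) : ℝ :=
  (Nat.card {x : α // P x} : ℝ) / (Nat.card α : ℝ)

end MFHS

namespace MFHS
open Finset

/-! The proof identifies `setH` with the integral bases of a polymatroid. Adding a node to `S`
raises `cutBound` by `d` minus the number of nodes of `S` outside that node's family. As families
have two nodes, this increment is `d - #S`, plus one if the family is already met, and hence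
`cutBound` is submodular. It reaches the file size `M` on every set with between `min k (d + 1)` and
`d + 1` nodes (`fileSize_le_cutBound`), so capping it at `M` gives a submodular function `cutRank`.
By `mem_setH_iff`, membership in `setH` means total `M` together with the cut constraint for every
set.

Reconstruction: every `k` nodes contain the support of some base (`exists_mem_setH_support`), and
its nonzero determinant lets them solve for the file.

Repair: if `x` fails and `h` is a base, its `h x` units can be moved to `h x` distinct helpers, one
each, giving another base `h'` (`exists_mem_setH_redistribute`). The determinant at `h'` is nonzero
before the repair, and suitable coefficients pass exactly the extra helper columns to `x`. Thus the
determinant at `h` after the repair is a nonzero polynomial in the coefficients. The product over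
all bases is then nonzero, and Schwartz–Zippel bounds the failure probability. Positive probability
gives existence, and induction over the failures gives the code. -/

/-! ### Submodular functions and redistribution of weight -/

/-- Local decreasing marginals imply submodularity: the larger set is built up one element at a
time, first for the marginal of a single point, then for that of a set. -/
lemma submodular_of_insert {α : Type*} [DecidableEq α] {F : Finset α → ℤ}
    (hF : ∀ S a b, a ∉ S → b ∉ S → a ≠ b →
      F (insert a (insert b S)) + F S ≤ F (insert a S) + F (insert b S)) (U V : Finset α) :
    F (U ∪ V) + F (U ∩ V) ≤ F U + F V := by
  have marginal : ∀ (a : α) (W S : Finset α), a ∉ S → a ∉ W → Disjoint S W →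
      F (insert a (S ∪ W)) + F S ≤ F (insert a S) + F (S ∪ W) := by
    intro a W
    induction W using Finset.induction_on with
    | empty => intro S _ _ _; simp
    | insert b W hb ih =>
      intro S haS haW hd
      simp only [mem_insert, not_or] at haW
      rw [disjoint_insert_right] at hd
      have h1 := ih S haS haW.2 hd.2
      have h2 := hF (S ∪ W) a b (by simp [haS, haW.2]) (by simp [hd.1, hb]) haW.1
      rw [union_insert]
      linarith
  have main : ∀ W S R : Finset α, R ⊆ S → Disjoint S W →
      F (S ∪ W) + F R ≤ F S + F (R ∪ W) := by
    intro W
    induction W using Finset.induction_on with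
    | empty => intro S R _ _; simp
    | insert b W hb ih =>
      intro S R hR hd
      rw [disjoint_insert_right] at hd
      have h1 := ih S R hR hd.2
      have h2 := marginal b (S \ R) (R ∪ W)
        (by simp only [mem_union, not_or]; exact ⟨fun h => hd.1 (hR h), hb⟩)
        (by simp [hd.1])
        (by
          rw [disjoint_union_left]
          exact ⟨disjoint_sdiff, (hd.2.mono_left sdiff_subset).symm⟩)
      have h3 : R ∪ W ∪ S \ R = S ∪ W := by
        rw [union_right_comm, union_sdiff_of_subset hR]
      rw [h3] at h2
      rw [union_insert, union_insert]
      linarith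
  have h := main (V \ U) U (U ∩ V) inter_subset_left disjoint_sdiff
  rw [union_sdiff_self_eq_union] at h
  have h2 : U ∩ V ∪ V \ U = V := by
    ext z; simp only [mem_union, mem_inter, mem_sdiff]; tauto
  rwa [h2] at h

/-- In an integral polymatroid, the weight of a point `x` can be moved to distinct points of `D`
if no set gains more than `#(D \ U)` from the addition of `x`. -/
lemma exists_redistribution {α : Type*} [DecidableEq α] {F : Finset α → ℤ}
    (hF0 : F ∅ = 0) (hF : ∀ U V, F (U ∪ V) + F (U ∩ V) ≤ F U + F V)
    {w : α → ℕ} (hw : ∀ S, ∑ i ∈ S, (w i : ℤ) ≤ F S) (x : α) (D : Finset α)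
    (hD : ∀ U, x ∉ U → F (insert x U) ≤ F U + ((D \ U).card : ℤ)) :
    ∃ T ⊆ D, T.card = w x ∧
      ∀ S, ∑ i ∈ S, (((if i = x then 0 else w i) + if i ∈ T then 1 else 0 : ℕ) : ℤ) ≤ F S := by
  classical
  set w' : Finset α → α → ℤ :=
    fun T i => (((if i = x then 0 else w i) + if i ∈ T then 1 else 0 : ℕ) : ℤ) with hw'
  have sum_mem : ∀ T S, x ∈ S →
      ∑ i ∈ S, w' T i = ∑ i ∈ S, (w i : ℤ) - w x + ((S ∩ T).card : ℤ) := by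
    intro T S hx
    simp only [hw', Nat.cast_add, sum_add_distrib, Nat.cast_ite, Nat.cast_zero, Nat.cast_one,
      sum_boole]
    rw [filter_mem_eq_inter, ← add_sum_erase S (fun i => (w i : ℤ)) hx, ← add_sum_erase S _ hx]
    rw [sum_congr rfl (g := fun i => (w i : ℤ))
      (fun i hi => by simp [ne_of_mem_erase hi])]
    simp
  have sum_notMem : ∀ T S, x ∉ S →
      ∑ i ∈ S, w' T i = ∑ i ∈ S, (w i : ℤ) + ((S ∩ T).card : ℤ) := by
    intro T S hx
    simp only [hw', Nat.cast_add, sum_add_distrib, Nat.cast_ite, Nat.cast_zero, Nat.cast_one,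
      sum_boole]
    rw [filter_mem_eq_inter, sum_congr rfl (g := fun i => (w i : ℤ))
      (fun i hi => by rw [if_neg (fun h : i = x => hx (h ▸ hi))])]
  -- A largest feasible `T` with at most `w x` elements has exactly `w x`; otherwise each remaining
  -- point of `D` is blocked by a tight set.
  let C := D.powerset.filter fun T => T.card ≤ w x ∧ ∀ S, ∑ i ∈ S, w' T i ≤ F S
  have hC : (∅ : Finset α) ∈ C := by
    simp only [C, mem_filter, mem_powerset, empty_subset, card_empty, zero_le, true_and]
    intro S
    by_cases hx : x ∈ S
    · rw [sum_mem _ _ hx]; have := hw S; simp; omega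
    · rw [sum_notMem _ _ hx]; have := hw S; simpa using this
  obtain ⟨T, hT, hmax⟩ := exists_max_image C card ⟨_, hC⟩
  simp only [C, mem_filter, mem_powerset] at hT hmax
  obtain ⟨hTD, hTc, hTF⟩ := hT
  refine ⟨T, hTD, ?_, hTF⟩
  by_contra hne
  have hlt : T.card < w x := lt_of_le_of_ne hTc hne
  have tight : ∀ y ∈ D \ T, ∃ U, y ∈ U ∧ x ∉ U ∧ ∑ i ∈ U, w' T i = F U := by
    intro y hy
    rw [mem_sdiff] at hy
    by_contra! hno
    have h1 : (insert y T).card ≤ T.card := by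
      refine hmax _ ⟨insert_subset hy.1 hTD, by rw [card_insert_of_notMem hy.2]; omega, ?_⟩
      intro S
      -- A set containing `x` never blocks: it has lost `w x` and gains at most `#T + 1 ≤ w x`.
      by_cases hx : x ∈ S
      · rw [sum_mem _ _ hx]
        have h2 : (S ∩ insert y T).card ≤ (insert y T).card := card_le_card inter_subset_right
        rw [card_insert_of_notMem hy.2] at h2
        have := hw S
        omega
      · by_cases hyS : y ∈ S
        · have h2 := lt_of_le_of_ne (hTF S) (hno S hyS hx)
          rw [sum_notMem _ _ hx] at h2 ⊢
          have h3 : (S ∩ insert y T).card ≤ (S ∩ T).card + 1 := by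
            rw [inter_insert_of_mem hyS]; exact card_insert_le _ _
          omega
        · have h2 := hTF S
          rw [sum_notMem _ _ hx] at h2 ⊢
          rwa [inter_insert_of_notMem hyS]
    rw [card_insert_of_notMem hy.2] at h1
    omega
  -- By submodularity, unions of tight sets are tight, so a single tight set avoiding `x` contains
  -- all of `D \ T`.
  have tight_all : ∀ E ⊆ D \ T, ∃ U, E ⊆ U ∧ x ∉ U ∧ ∑ i ∈ U, w' T i = F U := by
    intro E
    induction E using Finset.induction_on with
    | empty => intro _; exact ⟨∅, by simp, by simp, by simp [hF0]⟩
    | insert y E _ ih =>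
      intro hE
      obtain ⟨U, hEU, hxU, hU⟩ := ih ((subset_insert _ _).trans hE)
      obtain ⟨V, hyV, hxV, hV⟩ := tight y (hE (mem_insert_self _ _))
      refine ⟨U ∪ V, insert_subset (mem_union_right _ hyV) (hEU.trans subset_union_left),
        by simp [hxU, hxV], le_antisymm (hTF _) ?_⟩
      have h1 := sum_union_inter (s₁ := U) (s₂ := V) (f := w' T)
      have h2 := hTF (U ∩ V)
      have h3 := hF U V
      linarith
  obtain ⟨U, hDU, hxU, hU⟩ := tight_all _ subset_rfl
  rw [sum_notMem _ _ hxU] at hU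
  -- Comparing `U` with `insert x U` gives `w x ≤ #(U ∩ T) + #(D \ U) ≤ #T`, as `D \ U ⊆ T`.
  have h1 := hD U hxU
  have h2 := hw (insert x U)
  rw [sum_insert hxU] at h2
  have h3 : (U ∩ T).card + (D \ U).card ≤ T.card := by
    rw [← card_union_of_disjoint]
    · refine card_le_card (union_subset inter_subset_right fun z hz => ?_)
      rw [mem_sdiff] at hz
      by_contra hzT
      exact hz.2 (hDU (mem_sdiff.2 ⟨hz.1, hzT⟩))
    · exact disjoint_sdiff.mono_left inter_subset_left
  omega

/-! ### The cut rank function -/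

/-- The cut value of a set of nodes: the number of packets that its members receive from
outside when they are repaired one after the other, untruncated. -/
def cutBound (n d r : ℕ) (S : Finset (Fin n)) : ℤ :=
  ∑ i ∈ range S.card, ((d : ℤ) - i) + S.card - (S.image (family n d r)).card

/-- The cut value, truncated at `M`, and equal to `M` for sets of more than `d` nodes. -/
def cutRank (n d r M : ℕ) (S : Finset (Fin n)) : ℤ :=
  if S.card ≤ d then min (M : ℤ) (cutBound n d r S) else M

lemma cutBound_insert {n d r : ℕ} {S : Finset (Fin n)} {a : Fin n} (ha : a ∉ S) :
    cutBound n d r (insert a S) = cutBound n d r S + (d - S.card) +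
      if family n d r a ∈ S.image (family n d r) then 1 else 0 := by
  unfold cutBound
  rw [card_insert_of_notMem ha, sum_range_succ, image_insert]
  split_ifs with h
  · rw [insert_eq_of_mem h]; push_cast; ring
  · rw [card_insert_of_notMem h]; push_cast; ring

lemma cutRank_le (n d r M : ℕ) (S : Finset (Fin n)) : cutRank n d r M S ≤ M := by
  unfold cutRank
  split_ifs
  · exact min_le_left _ _
  · exact le_rfl

lemma cutRank_empty (n d r M : ℕ) : cutRank n d r M ∅ = 0 := by
  simp [cutRank, cutBound]

/-- At size `d + 1` both branches of the definition agree. This extra size lets a set of at most `d`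
nodes be compared with its one-point extensions. -/
lemma cutRank_eq_min {n d r M : ℕ} (hM : ∀ S, S.card = d + 1 → (M : ℤ) ≤ cutBound n d r S)
    {S : Finset (Fin n)} (hS : S.card ≤ d + 1) :
    cutRank n d r M S = min (M : ℤ) (cutBound n d r S) := by
  unfold cutRank
  split_ifs with h
  · rfl
  · exact (min_eq_left (hM S (by omega))).symm

/-- Adding `b` lowers the marginal of `a` by one, and at most restores it when `b` opens the family
of `a`. The cap at `M` is harmless because `cutBound` does not decrease up to size `d + 1`. -/
lemma cutRank_submodular {n d r M : ℕ}
    (hM : ∀ S, S.card = d + 1 → (M : ℤ) ≤ cutBound n d r S) (U V : Finset (Fin n)) :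
    cutRank n d r M (U ∪ V) + cutRank n d r M (U ∩ V) ≤
      cutRank n d r M U + cutRank n d r M V := by
  refine submodular_of_insert (fun S a b ha hb hab => ?_) U V
  have hab' : a ∉ insert b S := by simp [hab, ha]
  have ca := card_insert_of_notMem ha
  have cb := card_insert_of_notMem hb
  have cab := card_insert_of_notMem hab'
  rcases le_or_gt d S.card with h | h
  · have h1 := cutRank_le n d r M S
    have h2 := cutRank_le n d r M (insert a (insert b S))
    have h3 : ∀ c, c ∉ S → cutRank n d r M (insert c S) = M := by
      intro c hc
      unfold cutRank
      rw [if_neg (by rw [card_insert_of_notMem hc]; omega)]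
    rw [h3 a ha, h3 b hb]
    linarith
  · rw [cutRank_eq_min hM (by omega), cutRank_eq_min hM (by omega),
      cutRank_eq_min hM (by omega), cutRank_eq_min hM (by omega)]
    have e1 := cutBound_insert (d := d) (r := r) hab'
    have e2 := cutBound_insert (d := d) (r := r) ha
    have e3 := cutBound_insert (d := d) (r := r) hb
    have himg : family n d r a ∈ S.image (family n d r) →
        family n d r a ∈ (insert b S).image (family n d r) :=
      fun h => image_subset_image (subset_insert _ _) h
    split_ifs at e1 e2 e3 <;> omega

/-! ### Families of two nodes -/

lemma card_family_le_two {n d r : ℕ} (hfam : n - d - r = 2) (v : ℕ) :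
    (univ.filter fun x : Fin n => family n d r x = v).card ≤ 2 := by
  refine le_trans (card_le_card_of_injOn (t := ({2 * v, 2 * v + 1} : Finset ℕ))
    (fun x : Fin n => (x : ℕ)) (fun x hx => ?_) (fun x _ y _ h => Fin.ext h)) card_le_two
  simp only [coe_filter, mem_univ, true_and, Set.mem_ofPred_eq, family, hfam] at hx
  simp only [coe_insert, coe_singleton, Set.mem_insert_iff, Set.mem_singleton_iff]
  omega

lemma card_image_family_le {n d r : ℕ} (hfam : n - d - r = 2) (hcomplete : n % (n - d - r) = 0)
    (S : Finset (Fin n)) : (S.image (family n d r)).card ≤ n / 2 := by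
  rw [hfam] at hcomplete
  calc _ ≤ (range (n / 2)).card := card_le_card fun v hv => by
        obtain ⟨x, -, rfl⟩ := mem_image.1 hv
        simp only [mem_range, family, hfam]
        omega
    _ = n / 2 := card_range _

/-! ### Prefixes of an ordering of the nodes -/

/-- The first `m` nodes of the ordering `π`. -/
def prefixSet {n : ℕ} (π : Equiv.Perm (Fin n)) (m : ℕ) : Finset (Fin n) :=
  univ.filter fun x => (π.symm x : ℕ) < m

@[simp] lemma mem_prefixSet {n : ℕ} {π : Equiv.Perm (Fin n)} {m : ℕ} {x : Fin n} :
    x ∈ prefixSet π m ↔ (π.symm x : ℕ) < m := by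
  simp [prefixSet]

lemma prefixSet_zero {n : ℕ} (π : Equiv.Perm (Fin n)) : prefixSet π 0 = ∅ := by
  ext; simp

lemma apply_notMem_prefixSet {n m : ℕ} (π : Equiv.Perm (Fin n)) (hm : m < n) :
    π ⟨m, hm⟩ ∉ prefixSet π m := by
  simp

lemma prefixSet_succ {n m : ℕ} (π : Equiv.Perm (Fin n)) (hm : m < n) :
    prefixSet π (m + 1) = insert (π ⟨m, hm⟩) (prefixSet π m) := by
  ext x
  rw [mem_insert, ← π.symm_apply_eq]
  simp only [mem_prefixSet, Fin.ext_iff]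
  omega

lemma card_prefixSet {n m : ℕ} (π : Equiv.Perm (Fin n)) (hm : m ≤ n) :
    (prefixSet π m).card = m := by
  induction m with
  | zero => simp [prefixSet_zero]
  | succ m ih =>
    rw [prefixSet_succ π hm, card_insert_of_notMem (apply_notMem_prefixSet π hm), ih (by omega)]

lemma sum_prefixSet_succ {n m : ℕ} {A : Type*} [AddCommMonoid A] (π : Equiv.Perm (Fin n))
    (hm : m < n) (v : Fin n → A) :
    ∑ x ∈ prefixSet π (m + 1), v x = ∑ x ∈ prefixSet π m, v x + v (π ⟨m, hm⟩) := by
  rw [prefixSet_succ π hm, sum_insert (apply_notMem_prefixSet π hm), add_comm]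

lemma prefixSet_one_eq {n : ℕ} (i : Fin n) :
    univ.filter (fun j => j < i) = prefixSet (1 : Equiv.Perm (Fin n)) i := by
  ext j
  simp only [mem_filter, mem_univ, true_and, mem_prefixSet]
  rfl

/-- For a vector that is non-increasing along `π`, the `m` first coordinates are largest. -/
lemma largestSum_eq {n m : ℕ} {v : Fin n → ℕ} {π : Equiv.Perm (Fin n)}
    (hv : ∀ i j, i ≤ j → v (π j) ≤ v (π i)) (hm : m ≤ n) :
    largestSum v m = ∑ x ∈ prefixSet π m, v x := by
  refine le_antisymm (Finset.sup_le fun s hs => ?_) ?_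
  · rw [mem_powersetCard] at hs
    rcases Nat.eq_zero_or_pos m with rfl | hpos
    · simp [card_eq_zero.1 hs.2]
    -- The value `t` at the last prefix position separates the prefix from its complement; `s` and
    -- the prefix differ by equally many elements on either side of it.
    · set t := v (π ⟨m - 1, by omega⟩)
      have hc : (s \ prefixSet π m).card = (prefixSet π m \ s).card :=
        card_sdiff_comm (by rw [hs.2, card_prefixSet π hm])
      have h1 : ∑ x ∈ s \ prefixSet π m, v x ≤ (s \ prefixSet π m).card • t := by
        refine sum_le_card_nsmul _ _ _ fun x hx => ?_
        rw [mem_sdiff, mem_prefixSet] at hx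
        have := hv ⟨m - 1, by omega⟩ (π.symm x) (by rw [Fin.le_def]; simp; omega)
        rwa [π.apply_symm_apply] at this
      have h2 : (prefixSet π m \ s).card • t ≤ ∑ x ∈ prefixSet π m \ s, v x := by
        refine card_nsmul_le_sum _ _ _ fun x hx => ?_
        rw [mem_sdiff, mem_prefixSet] at hx
        have := hv (π.symm x) ⟨m - 1, by omega⟩ (by rw [Fin.le_def]; simp; omega)
        rwa [π.apply_symm_apply] at this
      rw [hc] at h1
      have h3 := sum_inter_add_sum_sdiff s (prefixSet π m) v
      have h4 := sum_inter_add_sum_sdiff (prefixSet π m) s v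
      rw [inter_comm] at h4
      omega
  · exact Finset.le_sup (f := fun s => ∑ i ∈ s, v i)
      (mem_powersetCard.2 ⟨subset_univ _, card_prefixSet π hm⟩)

/-! ### The vectors of an ordering -/

/-- At most one earlier node, the other member of the family, is not a candidate helper. -/
lemma zCount_add {n d r : ℕ} (hfam : n - d - r = 2) (π : Equiv.Perm (Fin n)) (i : Fin n) :
    zCount n d r π i + (if family n d r (π i) ∈ (prefixSet π i).image (family n d r)
      then 1 else 0) = i := by
  have h1 : zCount n d r π i =
      ((prefixSet π i).filter fun x => ¬ family n d r x = family n d r (π i)).card := by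
    unfold zCount
    refine card_bij (fun j _ => π j) ?_ (fun _ _ _ _ h => π.injective h) ?_
    · intro j hj
      simpa [candidateHelpers] using hj
    · intro x hx
      exact ⟨π.symm x, by simpa [candidateHelpers] using hx, by simp⟩
  have h2 : ((prefixSet π i).filter fun x => family n d r x = family n d r (π i)).card =
      if family n d r (π i) ∈ (prefixSet π i).image (family n d r) then 1 else 0 := by
    have h3 : ((prefixSet π i).filter fun x => family n d r x = family n d r (π i)).card + 1 ≤ 2 := by
      rw [← card_insert_of_notMem (a := π i) (by simp)]
      refine le_trans (card_le_card fun x hx => ?_) (card_family_le_two hfam (family n d r (π i)))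
      rw [mem_insert, mem_filter] at hx
      rw [mem_filter]
      exact ⟨mem_univ _, by rcases hx with rfl | hx; exacts [rfl, hx.2]⟩
    split_ifs with h
    · obtain ⟨x, hx, he⟩ := mem_image.1 h
      have := card_pos.2
        ⟨x, (mem_filter (p := fun x => family n d r x = family n d r (π i))).2 ⟨hx, he⟩⟩
      omega
    · rw [card_eq_zero, filter_eq_empty_iff]
      exact fun x hx he => h (mem_image.2 ⟨x, hx, he⟩)
  rw [h1, ← h2, add_comm, card_filter_add_card_filter_not, card_prefixSet π i.2.le]

/-- A later position costs at least one, and the family correction regains at most one. -/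
lemma bVec_anti {n d r : ℕ} (hfam : n - d - r = 2) (π : Equiv.Perm (Fin n)) {i j : Fin n}
    (hij : i ≤ j) : bVec n d r π j ≤ bVec n d r π i := by
  rcases hij.eq_or_lt with rfl | h
  · exact le_rfl
  · have h1 := zCount_add hfam π i
    have h2 := zCount_add hfam π j
    rw [Fin.lt_def] at h
    unfold bVec
    split_ifs at h1 h2 <;> omega

lemma cVec_anti {n d r : ℕ} (M : ℕ) (hfam : n - d - r = 2) (π : Equiv.Perm (Fin n)) {i j : Fin n}
    (hij : i ≤ j) : cVec n d r M π j ≤ cVec n d r M π i := by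
  unfold cVec
  refine min_le_min (bVec_anti hfam π hij) (Nat.sub_le_sub_left ?_ _)
  refine sum_le_sum_of_subset fun l hl => ?_
  simp only [mem_filter, mem_univ, true_and] at hl ⊢
  exact hl.trans_le hij

lemma cVec_le (n d r M : ℕ) (π : Equiv.Perm (Fin n)) (i : Fin n) : cVec n d r M π i ≤ d :=
  (min_le_left _ _).trans (Nat.sub_le _ _)

/-- The increments of `cutBound` along `π` are the integers `d - z_i`; the positive part is inactive
because `z_i ≤ i ≤ d`. -/
lemma sum_bVec {n d r m : ℕ} (hfam : n - d - r = 2) (π : Equiv.Perm (Fin n)) (hm : m ≤ d + 1) :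
    ((∑ i ∈ prefixSet 1 m, bVec n d r π i : ℕ) : ℤ) = cutBound n d r (prefixSet π m) := by
  induction m with
  | zero => simp [prefixSet_zero, cutBound]
  | succ m ih =>
    have hmn : m < n := by omega
    have h := zCount_add hfam π ⟨m, hmn⟩
    rw [sum_prefixSet_succ _ hmn, prefixSet_succ π hmn,
      cutBound_insert (apply_notMem_prefixSet π hmn), card_prefixSet π hmn.le, Nat.cast_add,
      ih (by omega)]
    simp only [Equiv.Perm.coe_one, id_eq, bVec] at h ⊢
    split_ifs at h ⊢ <;> omega

lemma sum_cVec {n d r M m : ℕ} (π : Equiv.Perm (Fin n)) (hm : m ≤ n) :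
    ∑ i ∈ prefixSet 1 m, cVec n d r M π i = min M (∑ i ∈ prefixSet 1 m, bVec n d r π i) := by
  induction m with
  | zero => simp [prefixSet_zero]
  | succ m ih =>
    rw [sum_prefixSet_succ _ hm, sum_prefixSet_succ _ hm, ih (by omega)]
    have h : cVec n d r M π ⟨m, hm⟩ =
        min (bVec n d r π ⟨m, hm⟩) (M - ∑ i ∈ prefixSet 1 m, bVec n d r π i) := by
      unfold cVec
      rw [prefixSet_one_eq]
    simp only [Equiv.Perm.coe_one, id_eq]
    omega

/-! ### The file size as a minimum cut -/

/-- An index recurs after `n / 2` positions, so an earlier equal index exists only in the second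
half, and then only once. -/
lemma le_yRotating_add {n d r i : ℕ} (hfam : n - d - r = 2) (hcomplete : n % (n - d - r) = 0)
    (hi : i < n) : i ≤ yRotating n d r i + if n / 2 ≤ i then 1 else 0 := by
  have h1 : ((range i).filter fun j =>
      rotatingFamilyIndex n d r j = rotatingFamilyIndex n d r i).card ≤
      if n / 2 ≤ i then 1 else 0 := by
    rw [hfam] at hcomplete
    simp only [rotatingFamilyIndex, hfam]
    split_ifs with h
    · refine card_le_one.2 fun a ha b hb => ?_
      simp only [mem_filter, mem_range] at ha hb
      have key : ∀ a, a < i → a % (n / 2) = i % (n / 2) → a = i - n / 2 := by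
        intro a ha he
        rw [Nat.mod_eq_sub_mod h, Nat.mod_eq_of_lt (by omega : i - n / 2 < n / 2)] at he
        rcases lt_or_ge a (n / 2) with h' | h'
        · rwa [Nat.mod_eq_of_lt h'] at he
        · rw [Nat.mod_eq_sub_mod h', Nat.mod_eq_of_lt (by omega)] at he
          omega
      rw [key a ha.1 ha.2, key b hb.1 hb.2]
    · rw [Nat.le_zero, card_eq_zero, filter_eq_empty_iff]
      intro a ha
      rw [mem_range] at ha
      rw [Nat.mod_eq_of_lt (by omega), Nat.mod_eq_of_lt (by omega)]
      omega
  have h2 : yRotating n d r i + ((range i).filter fun j =>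
      rotatingFamilyIndex n d r j = rotatingFamilyIndex n d r i).card = i := by
    unfold yRotating
    rw [add_comm, card_filter_add_card_filter_not, card_range]
  split_ifs at h1 ⊢ <;> omega

/-- With `s = #S`, both sides are compared with `∑ i < s, (d - i)` plus the excess of `s` over `n /
2`: a set of `s` nodes meets at most `min s (n / 2)` families. -/
lemma fileSize_le_cutBound {n k d r : ℕ} (hfam : n - d - r = 2) (hcomplete : n % (n - d - r) = 0)
    (hkn : k ≤ n) {S : Finset (Fin n)} (hSd : S.card ≤ d + 1) (hkS : min k (d + 1) ≤ S.card) :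
    (fileSize n k d r : ℤ) ≤ cutBound n d r S := by
  have h1 : fileSize n k d r ≤ ∑ i ∈ range S.card, (d - yRotating n d r i) := by
    refine sum_le_sum_of_ne_zero fun i hi h => ?_
    rw [mem_range] at hi ⊢
    by_contra hlt
    -- A term beyond `#S` occurs only if `#S = d + 1`; then `i ≥ d + 1` and `y_i ≥ i - 1 ≥ d`.
    refine h (Nat.sub_eq_zero_of_le ?_)
    have := le_yRotating_add hfam hcomplete (hi.trans_le hkn)
    split_ifs at this <;> omega
  have h2 : ((∑ i ∈ range S.card, (d - yRotating n d r i) : ℕ) : ℤ) ≤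
      ∑ i ∈ range S.card, ((d : ℤ) - i + if n / 2 ≤ i then 1 else 0) := by
    rw [Nat.cast_sum]
    refine sum_le_sum fun i hi => ?_
    rw [mem_range] at hi
    have := le_yRotating_add (i := i) hfam hcomplete (by omega)
    split_ifs at this ⊢ <;> omega
  have h3 : (range S.card).filter (fun i => n / 2 ≤ i) = range S.card \ range (n / 2) := by
    ext; simp
  have h4 := card_image_family_le hfam hcomplete S
  have h5 : (S.image (family n d r)).card ≤ S.card := card_image_le
  have h6 : (range S.card \ range (n / 2)).card = S.card - n / 2 := by
    rw [card_sdiff, card_range, range_inter_range, card_range]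
    omega
  rw [sum_add_distrib, sum_boole, h3, h6] at h2
  unfold cutBound
  omega

lemma cutRank_prefixSet {n d r M m : ℕ} (hfam : n - d - r = 2)
    (hM : ∀ S, S.card = d + 1 → (M : ℤ) ≤ cutBound n d r S) (π : Equiv.Perm (Fin n))
    (hm : m ≤ n) :
    cutRank n d r M (prefixSet π m) = min M (∑ i ∈ prefixSet 1 m, bVec n d r π i) := by
  rcases le_or_gt m (d + 1) with h | h
  · rw [cutRank_eq_min hM (by rwa [card_prefixSet π hm]), ← sum_bVec hfam π h]
    push_cast
    rfl
  · have h1 := hM (prefixSet π (d + 1)) (card_prefixSet π (by omega))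
    rw [← sum_bVec hfam π le_rfl] at h1
    have h2 : ∑ i ∈ prefixSet 1 (d + 1), bVec n d r π i ≤ ∑ i ∈ prefixSet 1 m, bVec n d r π i :=
      sum_le_sum_of_subset fun x hx => by
        rw [mem_prefixSet] at hx ⊢
        omega
    unfold cutRank
    rw [if_neg (by rw [card_prefixSet π hm]; omega)]
    omega

lemma largestSum_cVec {n d r M m : ℕ} (hfam : n - d - r = 2)
    (hM : ∀ S, S.card = d + 1 → (M : ℤ) ≤ cutBound n d r S) (π : Equiv.Perm (Fin n))
    (hm : m ≤ n) :
    (largestSum (cVec n d r M π) m : ℤ) = cutRank n d r M (prefixSet π m) := by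
  rw [largestSum_eq (π := 1) (fun i j h => cVec_anti M hfam π h) hm, sum_cVec π hm,
    cutRank_prefixSet hfam hM π hm]

/-- A vector satisfying the majorization condition along a sorting order satisfies all the cut
constraints: a smallest most violated set would be a prefix of that order. -/
lemma sum_le_cutRank {n d r M : ℕ} (hfam : n - d - r = 2)
    (hM : ∀ S, S.card = d + 1 → (M : ℤ) ≤ cutBound n d r S) {v : Fin n → ℕ}
    (hv : ∑ i, v i = M) {π : Equiv.Perm (Fin n)} (hanti : ∀ i j, i ≤ j → v (π j) ≤ v (π i))
    (hmaj : Majorizes (cVec n d r M π) v) (S : Finset (Fin n)) :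
    ∑ i ∈ S, (v i : ℤ) ≤ cutRank n d r M S := by
  classical
  set g : Finset (Fin n) → ℤ := fun S => cutRank n d r M S - ∑ i ∈ S, (v i : ℤ) with hg
  obtain ⟨A, -, hA⟩ := exists_min_image univ g ⟨∅, mem_univ _⟩
  obtain ⟨B, hB, hBmin⟩ := exists_min_image (univ.filter fun S => g S = g A) card
    ⟨A, by simp⟩
  rw [mem_filter] at hB
  by_contra! hlt
  have hgB : g B < 0 := by
    have := hA S (mem_univ _)
    simp only [hg] at this hB ⊢
    linarith
  have hle : ∀ S, g B ≤ g S := fun S => by rw [hB.2]; exact hA S (mem_univ _)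
  have hlt' : ∀ S, S.card < B.card → g B < g S := by
    intro S hS
    refine lt_of_le_of_ne (hle S) fun h => ?_
    have := hBmin S (by simp [← h, hB.2])
    omega
  have hsumB : ∑ i ∈ B, (v i : ℤ) ≤ M := by
    rw [← hv]
    push_cast
    exact sum_le_sum_of_subset_of_nonneg (subset_univ _) fun _ _ _ => by positivity
  have hcard : B.card ≤ d := by
    by_contra h
    have : cutRank n d r M B = M := if_neg h
    simp only [hg] at hgB
    omega
  have hrank : cutRank n d r M B = cutBound n d r B := by
    have h1 : cutRank n d r M B = min (M : ℤ) (cutBound n d r B) := if_pos hcard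
    simp only [hg] at hgB
    omega
  -- Removing a point of `B` strictly increases `g`, and adding one does not decrease it. The
  -- marginals differ by at most the family correction, so values in `B` strictly exceed those
  -- outside.
  have hin : ∀ a ∈ B, (d : ℤ) - B.card + 2 ≤ v a := by
    intro a ha
    have h1 := hlt' (B.erase a) (card_erase_lt_of_mem ha)
    have h2 := cutBound_insert (d := d) (r := r) (notMem_erase a B)
    have h3 := card_erase_add_one ha
    have h4 : cutRank n d r M (B.erase a) = min (M : ℤ) (cutBound n d r (B.erase a)) :=
      if_pos (by omega)
    have h5 := add_sum_erase B (fun i => (v i : ℤ)) ha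
    rw [insert_erase ha] at h2
    simp only [hg] at h1
    split_ifs at h2 <;> omega
  have hout : ∀ b ∉ B, (v b : ℤ) ≤ d - B.card + 1 := by
    intro b hb
    have h1 := hle (insert b B)
    have h2 := cutBound_insert (d := d) (r := r) hb
    have h3 := card_insert_of_notMem hb
    have h4 := cutRank_eq_min hM (S := insert b B) (by omega)
    have h5 := sum_insert (f := fun i => (v i : ℤ)) hb
    simp only [hg] at h1
    split_ifs at h2 <;> omega
  have hBn : B.card ≤ n := by simpa using card_le_univ B
  have hBpre : prefixSet π B.card = B := by
    symm
    apply eq_of_subset_of_card_le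
    · intro a ha
      by_contra hna
      obtain ⟨b, hb, hbB⟩ : ∃ b ∈ prefixSet π B.card, b ∉ B := by
        by_contra! hsub
        have h1 : insert a (prefixSet π B.card) ⊆ B := insert_subset ha hsub
        have h2 := card_le_card h1
        rw [card_insert_of_notMem hna, card_prefixSet π hBn] at h2
        omega
      rw [mem_prefixSet] at hna hb
      have h1 := hanti (π.symm b) (π.symm a) (by rw [Fin.le_def]; omega)
      rw [π.apply_symm_apply, π.apply_symm_apply] at h1
      have h2 := hin a ha
      have h3 := hout b hbB
      omega
    · rw [card_prefixSet π hBn]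
  have hpos : 1 ≤ B.card := by
    by_contra h
    have : B = ∅ := card_eq_zero.1 (by omega)
    simp [hg, this, cutRank_empty] at hgB
  have h1 := hmaj B.card (mem_Icc.2 ⟨hpos, hBn⟩)
  have h2 := largestSum_cVec hfam hM π hBn
  rw [largestSum_eq hanti hBn, hBpre] at h1
  rw [hBpre] at h2
  have h3 : ((∑ i ∈ B, v i : ℕ) : ℤ) = ∑ i ∈ B, (v i : ℤ) := Nat.cast_sum _ _
  simp only [hg] at hgB
  omega

/-- The vectors in `𝓗` are the integral bases of the polymatroid with rank function `cutRank`. -/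
lemma mem_setH_iff {n d r M : ℕ} (hfam : n - d - r = 2)
    (hM : ∀ S, S.card = d + 1 → (M : ℤ) ≤ cutBound n d r S) {h : Fin n → Fin (d + 1)} :
    h ∈ setH n d r M ↔ ∑ i, (h i : ℕ) = M ∧
      ∀ S, ∑ i ∈ S, ((h i : ℕ) : ℤ) ≤ cutRank n d r M S := by
  classical
  unfold setH
  rw [mem_filter, and_iff_right (mem_univ _)]
  refine and_congr_right fun hsum => ⟨?_, fun hS => ?_⟩
  · rintro ⟨π, hanti, hmaj⟩ S
    exact sum_le_cutRank hfam hM hsum (fun i j hij => hanti i j hij) hmaj S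
  · obtain ⟨π, hπ⟩ : ∃ π : Equiv.Perm (Fin n), ∀ i j, i ≤ j → h (π j) ≤ h (π i) :=
      ⟨Tuple.sort (fun i => OrderDual.toDual (h i)), fun i j hij =>
        Tuple.monotone_sort (fun i => OrderDual.toDual (h i)) hij⟩
    refine ⟨π, hπ, fun m hm => ?_⟩
    rw [mem_Icc] at hm
    have h1 := hS (prefixSet π m)
    rw [← largestSum_cVec hfam hM π hm.2] at h1
    rw [largestSum_eq (v := fun i => (h i : ℕ)) hπ hm.2]
    exact_mod_cast h1

/-- Every set of `k` nodes contains the support of a vector in `𝓗`. -/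
lemma exists_mem_setH_support {n k d r M : ℕ} (hfam : n - d - r = 2)
    (hk : ∀ S : Finset (Fin n), S.card = min k (d + 1) → (M : ℤ) ≤ cutBound n d r S)
    {S : Finset (Fin n)} (hS : S.card = k) :
    ∃ h ∈ setH n d r M, ∀ i ∉ S, h i = 0 := by
  classical
  have hkn : k ≤ n := by rw [← hS]; simpa using card_le_univ S
  -- The ordering lists `S` first; `c(π)` already reaches `M` there and vanishes afterwards.
  have e : {i : Fin n // (i : ℕ) < k} ≃ {x // x ∈ S} := by
    refine Fintype.equivOfCardEq ?_
    rw [Fintype.card_coe, hS, Fintype.card_subtype]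
    exact card_prefixSet 1 hkn
  set π : Equiv.Perm (Fin n) := e.extendSubtype with hπ
  have hout : ∀ x ∉ S, k ≤ (π.symm x : ℕ) := by
    intro x hx
    by_contra! h
    have := e.extendSubtype_mem (π.symm x) h
    rw [← hπ, π.apply_symm_apply] at this
    exact hx this
  have hb : M ≤ ∑ i ∈ prefixSet 1 k, bVec n d r π i := by
    have h1 := hk (prefixSet π (min k (d + 1))) (card_prefixSet π (by omega))
    rw [← sum_bVec hfam π (min_le_right _ _)] at h1
    refine le_trans (by exact_mod_cast h1) (sum_le_sum_of_subset fun x hx => ?_)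
    rw [mem_prefixSet] at hx ⊢
    omega
  have hck : ∑ i ∈ prefixSet 1 k, cVec n d r M π i = M := by
    rw [sum_cVec π hkn, min_eq_left hb]
  have hcn : ∑ i, cVec n d r M π i = M := by
    have h0 : prefixSet (1 : Equiv.Perm (Fin n)) n = univ := by ext; simp
    rw [← h0, sum_cVec π le_rfl, min_eq_left (hb.trans (sum_le_sum_of_subset fun x hx => ?_))]
    rw [mem_prefixSet] at hx ⊢
    omega
  have hc0 : ∀ i : Fin n, k ≤ (i : ℕ) → cVec n d r M π i = 0 := by
    intro i hi
    have h1 := sum_le_sum_of_subset (f := cVec n d r M π)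
      (subset_univ (insert i (prefixSet 1 k)))
    rw [hcn, sum_insert (fun h => absurd (mem_prefixSet.1 h) (not_lt.2 hi)), hck] at h1
    omega
  let h : Fin n → Fin (d + 1) :=
    fun x => ⟨cVec n d r M π (π.symm x), Nat.lt_succ_of_le (cVec_le n d r M π _)⟩
  refine ⟨h, ?_, fun x hx => Fin.ext (hc0 _ (hout x hx))⟩
  unfold setH
  rw [mem_filter, and_iff_right (mem_univ _)]
  have hval : (fun x => (h x : ℕ)) = fun x => cVec n d r M π (π.symm x) := rfl
  have hanti : ∀ i j, i ≤ j → h (π j) ≤ h (π i) := by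
    intro i j hij
    simp only [h, Equiv.symm_apply_apply, Fin.mk_le_mk]
    exact cVec_anti M hfam π hij
  refine ⟨?_, π, hanti, fun m hm => ?_⟩
  · rw [hval, Equiv.sum_comp π.symm (cVec n d r M π), hcn]
  · rw [mem_Icc] at hm
    rw [largestSum_eq (v := fun i => (h i : ℕ)) hanti hm.2,
      largestSum_eq (π := 1) (fun i j h => cVec_anti M hfam π h) hm.2, hval]
    refine le_of_eq (sum_equiv π.symm (fun x => ?_) fun _ _ => rfl)
    rw [mem_prefixSet, mem_prefixSet]
    rfl

/-- The columns selected at `x` can be replaced by one more column at each of `h x` suitable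
helpers. -/
lemma exists_mem_setH_redistribute {n d r M : ℕ} (hfam : n - d - r = 2)
    (hM : ∀ S, S.card = d + 1 → (M : ℤ) ≤ cutBound n d r S) {h : Fin n → Fin (d + 1)}
    (hh : h ∈ setH n d r M) {x : Fin n} {D : Finset (Fin n)} (hDcard : D.card = d)
    (hD : D ⊆ candidateHelpers n d r x) :
    ∃ h' ∈ setH n d r M, ∃ T ⊆ D, T.card = h x ∧ (h' x : ℕ) = 0 ∧
      (∀ i, i ≠ x → i ∉ T → h' i = h i) ∧ ∀ i ∈ T, (h' i : ℕ) = h i + 1 := by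
  classical
  rw [mem_setH_iff hfam hM] at hh
  -- `D ∩ U` lies in `U` and omits a family member of `x` if `U` has one, so `#(D \ U)` is at least
  -- the increment of `cutBound`.
  have hmarg : ∀ U, x ∉ U →
      cutRank n d r M (insert x U) ≤ cutRank n d r M U + ((D \ U).card : ℤ) := by
    intro U hxU
    have hcx := card_insert_of_notMem hxU
    rcases lt_or_ge d U.card with h1 | h1
    · have := cutRank_le n d r M (insert x U)
      have h2 : cutRank n d r M U = M := if_neg (by omega)
      omega
    · have h2 := cutRank_eq_min hM (S := U) (by omega)
      have h3 := cutRank_eq_min hM (S := insert x U) (by omega)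
      have h4 := cutBound_insert (d := d) (r := r) hxU
      have h5 : (D \ U).card + (D ∩ U).card = d := by rw [card_sdiff_add_card_inter, hDcard]
      have h6 : (D ∩ U).card + (if family n d r x ∈ U.image (family n d r) then 1 else 0) ≤
          U.card := by
        split_ifs with hf
        · obtain ⟨y, hy, hyx⟩ := mem_image.1 hf
          refine card_lt_card ⟨inter_subset_right, fun hsub => ?_⟩
          have := hD (mem_of_mem_inter_left (hsub hy))
          simp [candidateHelpers, hyx] at this
        · exact card_le_card inter_subset_right
      split_ifs at h4 h6 <;> omega
  obtain ⟨T, hTD, hTc, hT⟩ := exists_redistribution (cutRank_empty n d r M)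
    (cutRank_submodular hM) (w := fun i => (h i : ℕ)) hh.2 x D hmarg
  have hxT : x ∉ T := fun hx => by simpa [candidateHelpers] using hD (hTD hx)
  set w : Fin n → ℕ := fun i => (if i = x then 0 else (h i : ℕ)) + if i ∈ T then 1 else 0 with hw
  have hwd : ∀ i, w i ≤ d := by
    intro i
    have h1 := hT {i}
    rw [sum_singleton] at h1
    have h2 : cutRank n d r M {i} ≤ d := by
      rw [cutRank_eq_min hM (by simp)]
      refine (min_le_right _ _).trans ?_
      simp [cutBound]
    exact_mod_cast h1.trans h2
  have hwM : ∑ i, w i = M := by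
    simp only [hw, sum_add_distrib, sum_boole, filter_mem_eq_inter, univ_inter]
    rw [← hh.1, ← add_sum_erase univ _ (mem_univ x), ← add_sum_erase univ (fun i => (h i : ℕ))
      (mem_univ x), sum_congr rfl (g := fun i => (h i : ℕ))
      (fun i hi => by rw [if_neg (ne_of_mem_erase hi)])]
    simp [hTc, add_comm]
  refine ⟨fun i => ⟨w i, Nat.lt_succ_of_le (hwd i)⟩, (mem_setH_iff hfam hM).2 ⟨hwM, hT⟩, T, hTD,
    hTc, ?_, fun i hi hiT => Fin.ext ?_, fun i hi => ?_⟩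
  · simp [hw, hxT]
  · simp [hw, hi, hiT]
  · have : i ≠ x := fun e => hxT (e ▸ hi)
    simp [hw, this, hi]

/-! ### Determinants of selected columns -/

/-- Triviality of the left kernel does not depend on the order of the columns, so selections can be
compared without tracking permutations. -/
lemma selectedDet_ne_zero_iff {F : Type*} [Field F] {n d M : ℕ} {Q : CodeState F n d M}
    {h : Fin n → Fin (d + 1)} {hsum : ∑ i, (h i : ℕ) = M} :
    selectedDet Q h hsum ≠ 0 ↔ ∀ v : Fin M → F,
      (∀ i (c : Fin d), (c : ℕ) < h i → v ⬝ᵥ (fun a => Q i a c) = 0) → v = 0 := by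
  unfold selectedDet
  rw [Ne, ← Matrix.exists_vecMul_eq_zero_iff]
  push Not
  refine forall_congr' fun v => ⟨fun H hv => ?_, fun H hv0 hv => hv0 (H fun i c hc => ?_)⟩
  · by_contra hv0
    refine H hv0 (funext fun j => ?_)
    exact hv _ _ (finSigmaFinEquiv.symm (finCongr hsum.symm j)).2.2
  · have key : ∀ q, v ⬝ᵥ (fun a => selectedColumns Q h a q) = 0 := by
      intro q
      obtain ⟨j, rfl⟩ := ((finCongr hsum.symm).trans finSigmaFinEquiv.symm).surjective q
      exact congr_fun hv j
    exact key ⟨i, ⟨c, hc⟩⟩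

lemma invariant_iff {F : Type*} [Field F] {n d r M : ℕ} {Q : CodeState F n d M} :
    Invariant r Q ↔ ∀ h (hh : h ∈ setH n d r M), selectedDet Q h (sum_of_mem_setH hh) ≠ 0 := by
  unfold Invariant
  rw [prod_ne_zero_iff]
  simp

lemma recovers_of_selectedDet_ne_zero {F : Type*} [Field F] {n d M : ℕ} {Q : CodeState F n d M}
    {h : Fin n → Fin (d + 1)} {hsum : ∑ i, (h i : ℕ) = M} (hQ : selectedDet Q h hsum ≠ 0)
    {S : Finset (Fin n)} (hS : ∀ i ∉ S, h i = 0) : Recovers Q S := by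
  rw [selectedDet_ne_zero_iff] at hQ
  intro W X Y hXY
  ext a w
  refine sub_eq_zero.1 (congr_fun (hQ (fun a => X a w - Y a w) fun i c hc => ?_) a)
  by_cases hi : i ∈ S
  · have h1 := congr_fun (congr_fun (congr_fun hXY ⟨i, hi⟩) w) c
    simp only [Matrix.mul_apply, Matrix.transpose_apply] at h1
    simp only [dotProduct, sub_mul, sum_sub_distrib, h1, sub_self]
  · rw [hS i hi] at hc
    simp at hc

lemma exists_selectedDet_ne_zero {F : Type*} [Field F] {n d M : ℕ} (h : Fin n → Fin (d + 1))
    (hsum : ∑ i, (h i : ℕ) = M) : ∃ Q : CodeState F n d M, selectedDet Q h hsum ≠ 0 := by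
  let g : (Σ i : Fin n, Fin (h i)) ≃ Fin M := finSigmaFinEquiv.trans (finCongr hsum)
  refine ⟨fun i a c => if hc : (c : ℕ) < h i then
    if a = g ⟨i, ⟨c, hc⟩⟩ then 1 else 0 else 0, selectedDet_ne_zero_iff.2 fun v hv => ?_⟩
  ext a
  obtain ⟨⟨i, c⟩, rfl⟩ := g.surjective a
  have h1 := hv i ⟨c, c.2.trans_le (Nat.le_of_lt_succ (h i).2)⟩ c.2
  simpa [dotProduct] using h1

/-- If `Q` has full rank on a choice of columns that replaces the `h x` columns of the failed node
by one more column of each of `h x` helpers, then a suitable repair has full rank on `h`. -/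
lemma exists_repair_selectedDet_ne_zero {F : Type*} [Field F] {n d r M : ℕ}
    {Q : CodeState F n d M} (e : RepairEvent n d r) {h h' : Fin n → Fin (d + 1)}
    {hsum : ∑ i, (h i : ℕ) = M} {hsum' : ∑ i, (h' i : ℕ) = M} (hQ : selectedDet Q h' hsum' ≠ 0)
    {T : Finset (Fin n)} (hT : T ⊆ univ.map e.helper) (hTc : T.card = h e.failed)
    (hx : (h' e.failed : ℕ) = 0) (hout : ∀ i, i ≠ e.failed → i ∉ T → h' i = h i)
    (hin : ∀ i ∈ T, (h' i : ℕ) = h i + 1) :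
    ∃ c : RepairCoeffs F d, selectedDet (repair Q e c) h hsum ≠ 0 := by
  classical
  let J : Finset (Fin d) := univ.filter fun j => e.helper j ∈ T
  have hJ : J.map e.helper = T := by
    ext y
    simp only [J, mem_map, mem_filter, mem_univ, true_and]
    refine ⟨?_, fun hy => ?_⟩
    · rintro ⟨j, hj, rfl⟩; exact hj
    · obtain ⟨j, -, rfl⟩ := mem_map.1 (hT hy)
      exact ⟨j, hy, rfl⟩
  have hJc : J.card = h e.failed := by rw [← hTc, ← hJ, card_map]
  let g := J.equivFinOfCardEq hJc
  -- Counting from zero, column `h i` is the first one of helper `i` not selected by `h`. Each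
  -- helper in `T` sends it, and `Z` places these packets in the first `h e.failed` columns of the
  -- newcomer.
  let c : RepairCoeffs F d :=
    (fun j l => if (l : ℕ) = h (e.helper j) then 1 else 0,
      fun j l => if hj : j ∈ J then if (g ⟨j, hj⟩ : ℕ) = l then 1 else 0 else 0)
  refine ⟨c, selectedDet_ne_zero_iff.2 fun v hv => selectedDet_ne_zero_iff.1 hQ v fun i l hl => ?_⟩
  have hix : i ≠ e.failed := by
    rintro rfl
    omega
  by_cases hlt : (l : ℕ) < h i
  · have := hv i l hlt
    rwa [repair, Function.update_of_ne hix] at this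
  · have hiT : i ∈ T := by
      by_contra hiT
      rw [hout i hix hiT] at hl
      exact hlt hl
    have hle : (l : ℕ) = h i := by have := hin i hiT; omega
    rw [← hJ, mem_map] at hiT
    obtain ⟨j, hj, rfl⟩ := hiT
    have hgd : (g ⟨j, hj⟩ : ℕ) < d := (g ⟨j, hj⟩).2.trans_le (Nat.le_of_lt_succ (h e.failed).2)
    have h1 := hv e.failed ⟨g ⟨j, hj⟩, hgd⟩ (g ⟨j, hj⟩).2
    rw [repair, Function.update_self] at h1
    have h2 : ∀ a, newcomer Q e c a ⟨g ⟨j, hj⟩, hgd⟩ = Q (e.helper j) a l := by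
      intro a
      rw [newcomer, Matrix.mul_apply, sum_eq_single j]
      · have h3 : c.2 j ⟨g ⟨j, hj⟩, hgd⟩ = 1 := by simp [c, hj]
        rw [h3, mul_one, Matrix.of_apply, Matrix.mulVec, dotProduct, sum_eq_single l]
        · simp [c, hle]
        · intro l' _ hl'
          have : (l' : ℕ) ≠ h (e.helper j) := fun h => hl' (Fin.ext (h.trans hle.symm))
          simp [c, this]
        · simp
      · intro j' _ hj'
        have h3 : c.2 j' ⟨g ⟨j, hj⟩, hgd⟩ = 0 := by
          by_cases hm : j' ∈ J
          · have : (g ⟨j', hm⟩ : ℕ) ≠ g ⟨j, hj⟩ := by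
              intro h
              have := g.injective (Fin.ext h)
              rw [Subtype.mk.injEq] at this
              exact hj' this
            simp only [c, dif_pos hm, if_neg this]
          · simp only [c, dif_neg hm]
        rw [h3, mul_zero]
      · simp
    simpa only [h2] using h1

/-! ### Random coefficients -/

lemma uniformProb_congr {α β : Type*} (e : α ≃ β) {P : α → Prop} {R : β → Prop}
    (h : ∀ a, P a ↔ R (e a)) : uniformProb P = uniformProb R := by
  unfold uniformProb
  rw [Nat.card_congr e, Nat.card_congr (e.subtypeEquiv h)]

lemma exists_of_uniformProb_pos {α : Type*} {P : α → Prop} (h : 0 < uniformProb P) :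
    ∃ a, P a := by
  by_contra! hP
  have : IsEmpty {a // P a} := ⟨fun a => hP a.1 a.2⟩
  simp [uniformProb] at h

lemma one_sub_le_uniformProb_eval_ne_zero {F : Type*} [Field F] [Fintype F] {n : ℕ}
    {p : MvPolynomial (Fin n) F} (hp : p ≠ 0) :
    1 - (p.totalDegree : ℝ) / Fintype.card F ≤
      uniformProb fun x : Fin n → F => MvPolynomial.eval x p ≠ 0 := by
  classical
  have h1 := MvPolynomial.schwartz_zippel_totalDegree hp univ
  have h2 : Fintype.piFinset (fun _ : Fin n => (univ : Finset F)) = univ := by ext; simp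
  rw [h2, card_univ] at h1
  have h3 : (((univ.filter fun x : Fin n → F => MvPolynomial.eval x p = 0).card : ℝ)) /
      (Fintype.card F : ℝ) ^ n ≤ (p.totalDegree : ℝ) / Fintype.card F := by
    have := (NNRat.cast_le (K := ℝ)).2 h1
    push_cast at this
    exact this
  have h4 := card_filter_add_card_filter_not (s := univ)
    (fun x : Fin n → F => MvPolynomial.eval x p = 0)
  have h5 : (Fintype.card F : ℝ) ^ n ≠ 0 := pow_ne_zero _ (by simp)
  unfold uniformProb
  rw [Nat.card_eq_fintype_card, Nat.card_eq_fintype_card, Fintype.card_subtype]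
  rw [card_univ, Fintype.card_fun, Fintype.card_fin] at h4
  rw [Fintype.card_fun, Fintype.card_fin]
  have h6 : ((univ.filter fun x : Fin n → F => MvPolynomial.eval x p ≠ 0).card : ℝ) =
      (Fintype.card F : ℝ) ^ n -
        (univ.filter fun x : Fin n → F => MvPolynomial.eval x p = 0).card := by
    rw [eq_sub_iff_add_eq, add_comm]
    exact_mod_cast h4
  rw [h6]
  push_cast
  rw [sub_div, div_self h5]
  linarith

/-- Each factor may have its own witness: nonzero polynomials over a field have a nonzero product,
and their degrees add up. -/
lemma one_sub_le_uniformProb_prod_ne_zero {F : Type*} [Field F] [Fintype F] {α σ ι : Type*}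
    [Fintype σ] [Fintype ι] (φ : (σ → F) ≃ α) (p : ι → MvPolynomial σ F) (val : ι → α → F)
    (heval : ∀ i x, MvPolynomial.eval x (p i) = val i (φ x)) {D : ℕ}
    (hdeg : ∀ i, (p i).totalDegree ≤ D) (hne : ∀ i, ∃ a, val i a ≠ 0) :
    1 - ((Fintype.card ι * D : ℕ) : ℝ) / Fintype.card F ≤
      uniformProb fun a => ∏ i, val i a ≠ 0 := by
  let e := Fintype.equivFin σ
  have hp : MvPolynomial.rename e (∏ i, p i) ≠ 0 := by
    rw [Ne, map_eq_zero_iff _ (MvPolynomial.rename_injective _ e.injective), prod_eq_zero_iff]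
    rintro ⟨i, -, hi⟩
    obtain ⟨a, ha⟩ := hne i
    refine ha ?_
    rw [← φ.apply_symm_apply a, ← heval, hi, map_zero]
  have hd : (MvPolynomial.rename e (∏ i, p i)).totalDegree ≤ Fintype.card ι * D :=
    calc _ ≤ (∏ i, p i).totalDegree := MvPolynomial.totalDegree_rename_le _ _
      _ ≤ ∑ i, (p i).totalDegree := MvPolynomial.totalDegree_finsetProd _ _
      _ ≤ ∑ _i : ι, D := sum_le_sum fun i _ => hdeg i
      _ = _ := by simp
  have h1 := one_sub_le_uniformProb_eval_ne_zero hp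
  rw [uniformProb_congr ((Equiv.arrowCongr e.symm (Equiv.refl F)).trans φ)
    (R := fun a => ∏ i, val i a ≠ 0)] at h1
  · refine le_trans ?_ h1
    have : ((MvPolynomial.rename e (∏ i, p i)).totalDegree : ℝ) ≤
      ((Fintype.card ι * D : ℕ) : ℝ) := by exact_mod_cast hd
    gcongr
  · intro x
    rw [MvPolynomial.eval_rename, map_prod]
    simp only [heval]
    rfl

lemma totalDegree_det_le {F σ m : Type*} [CommRing F] [Fintype m] [DecidableEq m]
    (A : Matrix m m (MvPolynomial σ F)) (D : m → ℕ) (hA : ∀ a j, (A a j).totalDegree ≤ D j) :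
    A.det.totalDegree ≤ ∑ j, D j := by
  rw [Matrix.det_apply]
  refine MvPolynomial.totalDegree_finsetSum_le fun π _ => ?_
  have hsign : (Equiv.Perm.sign π • ∏ j, A (π j) j).totalDegree =
      (∏ j, A (π j) j).totalDegree := by
    rcases Int.units_eq_one_or (Equiv.Perm.sign π) with h | h <;> rw [h] <;> simp
  rw [hsign]
  exact (MvPolynomial.totalDegree_finsetProd _ _).trans (sum_le_sum fun j _ => hA _ _)

lemma selectedDet_eq_eval {F σ : Type*} [Field F] {n d M : ℕ}
    (P : CodeState (MvPolynomial σ F) n d M) (x : σ → F) (h : Fin n → Fin (d + 1))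
    (hsum : ∑ i, (h i : ℕ) = M) :
    MvPolynomial.eval x ((selectedColumns P h).submatrix id
      (fun j : Fin M => finSigmaFinEquiv.symm (finCongr hsum.symm j))).det =
    selectedDet (fun i a c => MvPolynomial.eval x (P i a c)) h hsum := by
  rw [RingHom.map_det]
  rfl

lemma totalDegree_selectedDet_le {F σ : Type*} [Field F] {n d M : ℕ}
    (P : CodeState (MvPolynomial σ F) n d M) (D : Fin n → ℕ)
    (hP : ∀ i a c, (P i a c).totalDegree ≤ D i) (h : Fin n → Fin (d + 1))
    (hsum : ∑ i, (h i : ℕ) = M) :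
    ((selectedColumns P h).submatrix id
      (fun j : Fin M => finSigmaFinEquiv.symm (finCongr hsum.symm j))).det.totalDegree ≤
    ∑ i, (h i : ℕ) * D i := by
  refine (totalDegree_det_le _
    (fun j => D (finSigmaFinEquiv.symm (finCongr hsum.symm j)).1) fun a j => hP _ _ _).trans ?_
  refine ((Equiv.sum_comp ((finCongr hsum.symm).trans finSigmaFinEquiv.symm)
    (fun q : Σ i : Fin n, Fin (h i) => D q.1)).trans ?_).le
  rw [Fintype.sum_sigma]
  simp

lemma uniformProb_invariant {F : Type*} [Field F] [Fintype F] (n d r M : ℕ) :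
    1 - (((setH n d r M).card * M : ℕ) : ℝ) / Fintype.card F ≤
      uniformProb fun Q : CodeState F n d M => Invariant r Q := by
  let P : CodeState (MvPolynomial (Fin n × Fin M × Fin d) F) n d M :=
    fun i a c => MvPolynomial.X (i, a, c)
  let φ : (Fin n × Fin M × Fin d → F) ≃ CodeState F n d M :=
    { toFun := fun x i a c => x (i, a, c)
      invFun := fun Q p => Q p.1 p.2.1 p.2.2
      left_inv := fun _ => rfl
      right_inv := fun _ => rfl }
  have h := one_sub_le_uniformProb_prod_ne_zero φ
    (fun h : setH n d r M => ((selectedColumns P h.1).submatrix id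
      (fun j : Fin M => finSigmaFinEquiv.symm
        (finCongr (sum_of_mem_setH h.2).symm j))).det)
    (fun h Q => selectedDet Q h.1 (sum_of_mem_setH h.2)) (D := M)
    (fun h x => by
      rw [selectedDet_eq_eval P x h.1 (sum_of_mem_setH h.2)]
      simp only [P, MvPolynomial.eval_X]
      rfl)
    (fun h => by
      refine (totalDegree_selectedDet_le P (fun _ => 1)
        (fun i a c => (MvPolynomial.totalDegree_X _).le) h.1 (sum_of_mem_setH h.2)).trans ?_
      simp only [mul_one]
      exact (sum_of_mem_setH h.2).le)
    (fun h => exists_selectedDet_ne_zero _ _)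
  rwa [Fintype.card_coe] at h

lemma uniformProb_repair {F : Type*} [Field F] [Fintype F] {n d r M : ℕ} (hfam : n - d - r = 2)
    (hM : ∀ S, S.card = d + 1 → (M : ℤ) ≤ cutBound n d r S) {Q : CodeState F n d M}
    (hQ : Invariant r Q) (e : RepairEvent n d r) :
    1 - (((setH n d r M).card * (2 * d) : ℕ) : ℝ) / Fintype.card F ≤
      uniformProb fun c : RepairCoeffs F d => Invariant r (repair Q e c) := by
  let P : CodeState (MvPolynomial ((Fin d × Fin d) ⊕ (Fin d × Fin d)) F) n d M :=
    fun i a c => if i = e.failed then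
      ∑ j, (∑ l, MvPolynomial.C (Q (e.helper j) a l) * MvPolynomial.X (Sum.inl (j, l))) *
        MvPolynomial.X (Sum.inr (j, c))
      else MvPolynomial.C (Q i a c)
  let φ : ((Fin d × Fin d) ⊕ (Fin d × Fin d) → F) ≃ RepairCoeffs F d :=
    { toFun := fun x => (fun j l => x (Sum.inl (j, l)), fun j c => x (Sum.inr (j, c)))
      invFun := fun c => Sum.elim (fun p => c.1 p.1 p.2) (fun p => c.2 p.1 p.2)
      left_inv := fun x => by ext p; cases p <;> rfl
      right_inv := fun _ => rfl }
  have h := one_sub_le_uniformProb_prod_ne_zero φ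
    (fun h : setH n d r M => ((selectedColumns P h.1).submatrix id
      (fun j : Fin M => finSigmaFinEquiv.symm
        (finCongr (sum_of_mem_setH h.2).symm j))).det)
    (fun h c => selectedDet (repair Q e c) h.1 (sum_of_mem_setH h.2)) (D := 2 * d)
    (fun h x => by
      rw [selectedDet_eq_eval P x h.1 (sum_of_mem_setH h.2)]
      congr 1
      funext i a c
      by_cases hi : i = e.failed
      · subst hi
        simp only [P, if_true, repair, Function.update_self, newcomer, Matrix.mul_apply,
          Matrix.of_apply, Matrix.mulVec, dotProduct, map_sum, map_mul, MvPolynomial.eval_C,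
          MvPolynomial.eval_X]
        rfl
      · simp only [P, if_neg hi, repair, Function.update_of_ne hi, MvPolynomial.eval_C])
    (fun h => by
      -- Entries of the newcomer are bilinear in the `b_j` and `Z`; at most `d` of its columns are
      -- selected, giving degree at most `2 * d`.
      refine (totalDegree_selectedDet_le P (fun i => if i = e.failed then 2 else 0)
        (fun i a c => ?_) h.1 (sum_of_mem_setH h.2)).trans ?_
      · by_cases hi : i = e.failed
        · simp only [P, if_pos hi]
          refine MvPolynomial.totalDegree_finsetSum_le fun j _ => ?_
          refine (MvPolynomial.totalDegree_mul _ _).trans ?_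
          refine Nat.add_le_add (b := 1) (d := 1) ?_ (MvPolynomial.totalDegree_X _).le
          refine MvPolynomial.totalDegree_finsetSum_le fun l _ => ?_
          refine (MvPolynomial.totalDegree_mul _ _).trans ?_
          rw [MvPolynomial.totalDegree_C, MvPolynomial.totalDegree_X]
        · simp only [P, if_neg hi, MvPolynomial.totalDegree_C, le_refl]
      · simp only [mul_ite, mul_zero, sum_ite_eq', mem_univ, if_true]
        have := (h.1 e.failed).2
        omega)
    (fun h => by
      obtain ⟨h', hh', T, hT, hTc, hx, hout, hin⟩ := exists_mem_setH_redistribute hfam hM h.2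
        (x := e.failed) (D := univ.map e.helper) (by simp) (fun y hy => by
          obtain ⟨j, -, rfl⟩ := mem_map.1 hy
          exact e.helper_mem j)
      exact exists_repair_selectedDet_ne_zero e (invariant_iff.1 hQ h' hh') hT hTc hx hout hin)
  rwa [Fintype.card_coe] at h

/-! ### Existence of the code and the main theorem -/

/-- If every state satisfying a property can be repaired so that it is preserved, then some code
preserves it through all failures. -/
lemma exists_code {F : Type*} [Field F] {n d r M : ℕ} (I : CodeState F n d M → Prop)
    (hinit : ∃ Q, I Q) (hrep : ∀ Q, I Q → ∀ e : RepairEvent n d r, ∃ c, I (repair Q e c)) :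
    ∃ C : LinearLRRC F n d r M, ∀ events, I (C.state events) := by
  classical
  obtain ⟨Q₀, hQ₀⟩ := hinit
  choose coeffs hcoeffs using hrep
  let step : CodeState F n d M → RepairEvent n d r → RepairCoeffs F d :=
    fun Q e => if hQ : I Q then coeffs Q hQ e else 0
  let states : List (RepairEvent n d r) → CodeState F n d M :=
    fun es => es.foldr (fun e Q => repair Q e (step Q e)) Q₀
  let C : LinearLRRC F n d r M := ⟨Q₀, fun es e => step (states es) e⟩
  have hstate : ∀ es, C.state es = states es := by
    intro es
    induction es with
    | nil => rfl
    | cons e es ih =>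
      rw [LinearLRRC.state, ih]
      rfl
  refine ⟨C, fun es => ?_⟩
  induction es with
  | nil => exact hQ₀
  | cons e es ih =>
    rw [LinearLRRC.state]
    have h1 : C.rule es e = coeffs (C.state es) ih e := by
      change step (states es) e = _
      rw [← hstate es]
      exact dif_pos ih
    rw [h1]
    exact hcoeffs _ ih e

lemma le_fileSize {n k d r : ℕ} (hk : 1 ≤ k) : d ≤ fileSize n k d r := by
  have h : yRotating n d r 0 = 0 := by simp [yRotating]
  have h1 := single_le_sum_of_canonicallyOrdered (f := fun i => d - yRotating n d r i)
    (mem_range.2 hk)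
  simpa [h, fileSize] using h1

end MFHS

theorem mainTheorem1 {F : Type*} [Field F] [Fintype F] (n k d r : ℕ)
    (hd : 1 ≤ d) (hk : 1 ≤ k) (hkn : k ≤ n)
    (hfam : n - d - r = 2) (hcomplete : n % (n - d - r) = 0)
    (hq : n * d * MFHS.fileSize n k d r * (MFHS.setH n d r (MFHS.fileSize n k d r)).card
      < Fintype.card F) :
    -- a code exists: after any failures and repairs, the file survives any `n - k` failures
    (∃ C : MFHS.LinearLRRC F n d r (MFHS.fileSize n k d r),
      ∀ events : List (MFHS.RepairEvent n d r),
        MFHS.Invariant r (C.state events) ∧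
        ∀ S : Finset (Fin n), S.card = k → MFHS.Recovers (C.state events) S) ∧
    -- the invariant suffices for reconstruction from any `k` nodes
    (∀ Q : MFHS.CodeState F n d (MFHS.fileSize n k d r), MFHS.Invariant r Q →
      ∀ S : Finset (Fin n), S.card = k → MFHS.Recovers Q S) ∧
    -- uniformly random initial coding matrices satisfy the invariant with positive probability
    (0 < 1 - ((n * d * MFHS.fileSize n k d r *
          (MFHS.setH n d r (MFHS.fileSize n k d r)).card : ℕ) : ℝ) / (Fintype.card F : ℝ) ∧
      1 - ((n * d * MFHS.fileSize n k d r *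
          (MFHS.setH n d r (MFHS.fileSize n k d r)).card : ℕ) : ℝ) / (Fintype.card F : ℝ) ≤
        MFHS.uniformProb fun Q : MFHS.CodeState F n d (MFHS.fileSize n k d r) =>
          MFHS.Invariant r Q) ∧
    -- uniformly random repair coefficients preserve the invariant with positive probability
    (0 < 1 - ((2 * d ^ 2 *
          (MFHS.setH n d r (MFHS.fileSize n k d r)).card : ℕ) : ℝ) / (Fintype.card F : ℝ) ∧
      ∀ Q : MFHS.CodeState F n d (MFHS.fileSize n k d r), MFHS.Invariant r Q →
        ∀ e : MFHS.RepairEvent n d r,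
          1 - ((2 * d ^ 2 *
            (MFHS.setH n d r (MFHS.fileSize n k d r)).card : ℕ) : ℝ) / (Fintype.card F : ℝ) ≤
          MFHS.uniformProb fun c : MFHS.RepairCoeffs F d =>
            MFHS.Invariant r (MFHS.repair Q e c)) := by
  classical
  have hcut : ∀ S : Finset (Fin n), S.card ≤ d + 1 → min k (d + 1) ≤ S.card →
      (MFHS.fileSize n k d r : ℤ) ≤ MFHS.cutBound n d r S :=
    fun S h1 h2 => MFHS.fileSize_le_cutBound hfam hcomplete hkn h1 h2
  have hdM : d ≤ MFHS.fileSize n k d r := MFHS.le_fileSize hk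
  set M := MFHS.fileSize n k d r
  set H := MFHS.setH n d r M
  have hM : ∀ S : Finset (Fin n), S.card = d + 1 → (M : ℤ) ≤ MFHS.cutBound n d r S :=
    fun S hS => hcut S hS.le (hS ▸ min_le_right _ _)
  have hrec : ∀ Q : MFHS.CodeState F n d M, MFHS.Invariant r Q →
      ∀ S : Finset (Fin n), S.card = k → MFHS.Recovers Q S := by
    intro Q hQ S hS
    obtain ⟨h, hh, hsupp⟩ := MFHS.exists_mem_setH_support hfam
      (fun S hS => hcut S (hS ▸ min_le_right _ _) hS.ge) hS
    exact MFHS.recovers_of_selectedDet_ne_zero (MFHS.invariant_iff.1 hQ h hh) hsupp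
  have hF : (0 : ℝ) < Fintype.card F := by exact_mod_cast Fintype.card_pos
  have pos : ∀ a : ℕ, a < Fintype.card F → (0 : ℝ) < 1 - (a : ℝ) / Fintype.card F := by
    intro a ha
    rw [sub_pos, div_lt_one hF]
    exact_mod_cast ha
  have mono : ∀ a b : ℕ, a ≤ b →
      1 - (b : ℝ) / Fintype.card F ≤ 1 - (a : ℝ) / Fintype.card F := by
    intro a b hab
    gcongr
  have hinit := (mono _ _ (by
    calc H.card * M = 1 * 1 * M * H.card := by ring
      _ ≤ n * d * M * H.card := by gcongr; omega)).trans (MFHS.uniformProb_invariant n d r M)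
  have hrepair : ∀ Q : MFHS.CodeState F n d M, MFHS.Invariant r Q →
      ∀ e : MFHS.RepairEvent n d r, 1 - ((2 * d ^ 2 * H.card : ℕ) : ℝ) / (Fintype.card F : ℝ) ≤
        MFHS.uniformProb fun c : MFHS.RepairCoeffs F d => MFHS.Invariant r (MFHS.repair Q e c) :=
    fun Q hQ e => (mono _ _ (by
      calc H.card * (2 * d) = 2 * (d * 1) * H.card := by ring
        _ ≤ 2 * (d * d) * H.card := by gcongr
        _ = 2 * d ^ 2 * H.card := by ring)).trans (MFHS.uniformProb_repair hfam hM hQ e)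
  have hpos : (0 : ℝ) < 1 - ((2 * d ^ 2 * H.card : ℕ) : ℝ) / (Fintype.card F : ℝ) := by
    refine pos _ (lt_of_le_of_lt ?_ hq)
    -- Here `2 ≤ n` because `n - d - r = 2`, and `d ≤ M` because the first term of the file size is
    -- `d`.
    calc 2 * d ^ 2 * H.card = 2 * d * d * H.card := by ring
      _ ≤ n * d * M * H.card := by gcongr; omega
  refine ⟨?_, hrec, ⟨pos _ hq, hinit⟩, hpos, hrepair⟩
  obtain ⟨C, hC⟩ := MFHS.exists_code (r := r) (fun Q : MFHS.CodeState F n d M => MFHS.Invariant r Q)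
    (MFHS.exists_of_uniformProb_pos ((pos _ hq).trans_le hinit))
    (fun Q hQ e => MFHS.exists_of_uniformProb_pos (hpos.trans_le (hrepair Q hQ e)))
  exact ⟨C, fun events => ⟨hC events, hrec _ (hC events)⟩⟩
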